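/- Let $d,d'\ge 1$, $T>0$, $\mathcal O=[0,T]\times\mathbb R^d$, and let $\mu:\mathcal O\to\mathbb R^d$, $\sigma:\mathcal O\to\mathbb R^{d\times d'}$ be measurable, locally Lipschitz and of linear growth in the space variable, uniformly in $t\in[0,T]$. Let $W$ be a $d'$-dimensional Brownian motion on a filtered probability space $(\Omega,\mathcal F,(\mathcal G_s)_{s\in[0,T]},\mathsf Q)$ and, for $(t,z)\in\mathcal O$, let $Z^{t,z}$ be the strong solution of $$Z_s=z+\int_t^s\mu(r,Z_r)\,dr+\int_t^s\sigma(r,Z_r)\,dW_r,\qquad s\in[t,T].$$ Assume that for every $\delta>0$ and every sequence $(t_n,z_n)\in\mathcal O$ converging to $(t,z)\in\mathcal O$ $$\lim_{n\to\infty}\mathsf E^{\mathsf Q}\Big[\sup_{s\in[0,\delta]}\big|Z^{t_n,z_n}_{(t_n+s)\wedge T}-Z^{t,z}_{(t+s)\wedge T}\big|\Big]=0.$$ Let $t_0\in(0,T]$, let $A_0\subset\mathbb R^d$ be open, $\mathcal D=\{t_0\}\times\overline{A_0}$, $\mathcal C=\mathcal O\setminus\mathcal D$, and assume that $\mathsf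 Q(Z^{t,z}_{t_0}\in\partial A_0)=0$ for all $(t,z)\in[0,t_0)\times\mathbb R^d$. Put $\tau^{t,z}=\inf\{s\in[t,T]:(s,Z^{t,z}_s)\in\mathcal D\}$, with $\inf\varnothing=\infty$. Then $$\lim_{n\to\infty}\mathsf Q\big(\big|\tau^{t_n,z_n}\wedge(2T)-\tau^{t,z}\wedge(2T)\big|>\varepsilon\big)=0\quad\text{for all }\varepsilon>0$$ holds (i) for every sequence $(t_n,z_n)$ in $\mathcal C$ converging to a point $(t,z)\in\mathcal C$, and (ii) for every sequence $(t_n,z_n)$ in $\mathcal C$ with $t_n<t_0$ converging to a point $(t,z)\in\{t_0\}\times A_0$. Consequently, if moreover $f:\mathcal O\to[0,\infty)$ is continuous on $\overline{\mathcal C}$ and $g:\mathbb R^d\to[0,\infty)$ is continuous, then the function $$u(t,z)=\mathsf E^{\mathsf Q}\Big[\exp\Big(-\tfrac12\int_t^T f(s,Z^{t,z}_s)\,ds-\tfrac12 g(Z^{t,z}_T)\Big)1_{\{T<\tau^{t,z}\}}\Big]$$ is continuous on $\mathcal C$, and its restriction to $[0,t_0]\times\mathbb R^d$ is continuous on $([0,t_0]\times\mathbb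 R^d)\setminus(\{t_0\}\times\partial A_0)$. -/

import Mathlib

open MeasureTheory ProbabilityTheory Filter Topology Set
open scoped ENNReal

noncomputable section

namespace KilledDiffusion

/-- `ℝⁿ` with the Euclidean norm. -/
abbrev Eucl (n : ℕ) : Type := EuclideanSpace ℝ (Fin n)

/-- The state space `𝒪 = [0, T] × ℝᵈ`, as a set of pairs (time, position). -/
def stateSpace (d : ℕ) (T : ℝ) : Set (ℝ × Eucl d) := Icc 0 T ×ˢ univ

/-- The Euclidean norm `(∑ i, ∑ j, |A i j|²)^{1/2}` of a matrix. -/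
def matrixNorm {m n : ℕ} (A : Matrix (Fin m) (Fin n) ℝ) : ℝ :=
  √(∑ i, ∑ j, A i j ^ 2)

/-- Standing conditions on the drift `μ` and the diffusion matrix `σ` on `[0, T] × ℝᵈ`: they are
measurable, locally Lipschitz in space and of linear growth, both uniformly in time. -/
structure CoefficientConditions {d d' : ℕ} (T : ℝ) (μ : ℝ × Eucl d → Eucl d)
    (σ : ℝ × Eucl d → Matrix (Fin d) (Fin d') ℝ) : Prop where
  measurable_drift : Measurable ((stateSpace d T).domRestrict μ)
  measurable_diffusion : ∀ i j, Measurable ((stateSpace d T).domRestrict fun p => σ p i j)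
  locally_lipschitz : ∀ R : ℝ, ∃ L : ℝ, ∀ s ∈ Icc 0 T, ∀ x y : Eucl d, ‖x‖ ≤ R → ‖y‖ ≤ R →
    ‖μ (s, x) - μ (s, y)‖ + matrixNorm (σ (s, x) - σ (s, y)) ≤ L * ‖x - y‖
  linear_growth : ∃ K : ℝ, ∀ s ∈ Icc 0 T, ∀ x : Eucl d,
    ‖μ (s, x)‖ + matrixNorm (σ (s, x)) ≤ K * (1 + ‖x‖)

variable {Ω : Type*}

/-- `W` is an `n`-dimensional standard Brownian motion on `[0, T]` with respect to the
filtration `𝒢` under `Q`. -/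
structure IsBrownianMotion {mΩ : MeasurableSpace Ω} {n : ℕ} (T : ℝ) (Q : Measure Ω)
    (𝒢 : Filtration ℝ mΩ) (W : ℝ → Ω → Eucl n) : Prop where
  adapted : ∀ s ∈ Icc 0 T, Measurable[𝒢 s] (W s)
  zero : ∀ᵐ ω ∂Q, W 0 ω = 0
  continuous_paths : ∀ᵐ ω ∂Q, ContinuousOn (fun s => W s ω) (Icc 0 T)
  indep_increments : ∀ r s, 0 ≤ r → r ≤ s → s ≤ T →
    Indep (MeasurableSpace.comap (fun ω => W s ω - W r ω) inferInstance) (𝒢 r) Q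
  law_increments : ∀ r s, 0 ≤ r → r ≤ s → s ≤ T →
    Q.map (fun ω => W s ω - W r ω) = multivariateGaussian 0 ((s - r) • 1)

/-- The `σ`-algebra at time `s` of the filtration generated by `W`, augmented with the
`Q`-null sets. (A set of outer measure zero is a subset of a measurable null set.) -/
@[reducible] def augmentedFiltration {_ : MeasurableSpace Ω} {n : ℕ} (Q : Measure Ω)
    (W : ℝ → Ω → Eucl n) (s : ℝ) : MeasurableSpace Ω :=
  (⨆ r ∈ Icc 0 s, MeasurableSpace.comap (W r) inferInstance) ⊔
    MeasurableSpace.generateFrom {N | Q N = 0}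

/-- A simple real-valued process `∑_{i < n} ξᵢ 1_{(sᵢ, sᵢ₊₁]}` on `[t, T]`, with bounded
coefficients `ξᵢ` that are measurable at time `sᵢ`. -/
structure SimpleIntegrand (ℱ : ℝ → MeasurableSpace Ω) (t T : ℝ) where
  n : ℕ
  time : ℕ → ℝ
  time_mono : Monotone time
  time_mem : ∀ i, time i ∈ Icc t T
  coef : ℕ → Ω → ℝ
  coef_measurable : ∀ i, Measurable[ℱ (time i)] (coef i)
  coef_bounded : ∃ K : ℝ, ∀ i ω, |coef i ω| ≤ K

/-- The value of a simple process at time `s`. -/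
def SimpleIntegrand.value {ℱ : ℝ → MeasurableSpace Ω} {t T : ℝ} (H : SimpleIntegrand ℱ t T)
    (s : ℝ) (ω : Ω) : ℝ :=
  ∑ i ∈ Finset.range H.n, (Ioc (H.time i) (H.time (i + 1))).indicator (fun _ => H.coef i ω) s

/-- The stochastic integral `∫ₜʳ H dB` of a simple process. -/
def SimpleIntegrand.integral {ℱ : ℝ → MeasurableSpace Ω} {t T : ℝ} (H : SimpleIntegrand ℱ t T)
    (B : ℝ → Ω → ℝ) (r : ℝ) (ω : Ω) : ℝ :=
  ∑ i ∈ Finset.range H.n, H.coef i ω * (B (min r (H.time (i + 1))) ω - B (min r (H.time i)) ω)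

/-- `M` is (a version of) the Itô integral `M_r = ∫ₜʳ H dB`, `r ∈ [t, T]`: there are simple
processes `Hₖ` with `∫ₜᵀ |Hₖ - H|² ds → 0` in probability whose stochastic integrals converge
to `M` in probability, uniformly on `[t, T]`. -/
def IsItoIntegral {_ : MeasurableSpace Ω} (Q : Measure Ω) (ℱ : ℝ → MeasurableSpace Ω)
    (B : ℝ → Ω → ℝ) (t T : ℝ) (H M : ℝ → Ω → ℝ) : Prop :=
  ∃ S : ℕ → SimpleIntegrand ℱ t T,
    (∀ ε : ℝ≥0∞, 0 < ε → Tendsto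
      (fun k => Q {ω | ε < ∫⁻ s in Icc t T, ‖(S k).value s ω - H s ω‖ₑ ^ 2}) atTop (𝓝 0)) ∧
    (∀ ε : ℝ≥0∞, 0 < ε → Tendsto
      (fun k => Q {ω | ε < ⨆ r ∈ Icc t T, ‖(S k).integral B r ω - M r ω‖ₑ}) atTop (𝓝 0))

/-- `X` is a strong solution on `[t, T]`, where `p = (t, z)`, of
`X_s = z + ∫ₜˢ μ(r, X_r) dr + ∫ₜˢ σ(r, X_r) dW_r`: it has continuous paths, is adapted to the
augmented Brownian filtration, and satisfies the equation almost surely. The process `M i j` is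
the Itô integral of the entry `σᵢⱼ(r, X_r)` with respect to the coordinate `Wʲ`. -/
structure IsStrongSolution {_ : MeasurableSpace Ω} {d d' : ℕ} (T : ℝ)
    (μ : ℝ × Eucl d → Eucl d) (σ : ℝ × Eucl d → Matrix (Fin d) (Fin d') ℝ) (Q : Measure Ω)
    (W : ℝ → Ω → Eucl d') (p : ℝ × Eucl d) (X : ℝ → Ω → Eucl d) : Prop where
  continuous_paths : ∀ ω, ContinuousOn (fun s => X s ω) (Icc p.1 T)
  adapted : ∀ s ∈ Icc p.1 T, Measurable[augmentedFiltration Q W s] (X s)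
  initial : ∀ᵐ ω ∂Q, X p.1 ω = p.2
  equation : ∃ M : Fin d → Fin d' → ℝ → Ω → ℝ,
    (∀ i j, IsItoIntegral Q (augmentedFiltration Q W) (fun s ω => W s ω j) p.1 T
      (fun s ω => σ (s, X s ω) i j) (M i j)) ∧
    ∀ᵐ ω ∂Q, ∀ s ∈ Icc p.1 T, ∀ i,
      X s ω i = p.2 i + (∫ r in p.1..s, μ (r, X r ω) i) + ∑ j, M i j s ω

/-- The entry time `inf {s ∈ [t, T] : (s, X_s(ω)) ∈ D}` of the time-space process started at
time `t`, with `inf ∅ = ∞`. -/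
def entryTime {d : ℕ} (T : ℝ) (D : Set (ℝ × Eucl d)) (t : ℝ) (X : ℝ → Ω → Eucl d) (ω : Ω) :
    EReal :=
  sInf ((fun s : ℝ => (s : EReal)) '' {s | s ∈ Icc t T ∧ (s, X s ω) ∈ D})

/-- `L¹`-continuity of the flow `(t, z) ↦ Z^{t,z}`: for every `δ > 0` and all points
`(tₙ, zₙ) → (t, z)` of `𝒪`,
`E[sup_{0 ≤ s ≤ δ} |Z^{tₙ,zₙ}_{(tₙ+s) ∧ T} - Z^{t,z}_{(t+s) ∧ T}|] → 0`. -/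
def FlowContinuous {_ : MeasurableSpace Ω} {d : ℕ} (T : ℝ) (Q : Measure Ω)
    (Z : ℝ × Eucl d → ℝ → Ω → Eucl d) : Prop :=
  ∀ δ : ℝ, 0 < δ → ∀ (q : ℕ → ℝ × Eucl d) (p : ℝ × Eucl d),
    (∀ n, q n ∈ stateSpace d T) → p ∈ stateSpace d T → Tendsto q atTop (𝓝 p) →
    Tendsto (fun n => ∫⁻ ω, ⨆ s ∈ Icc 0 δ,
      ‖Z (q n) (min ((q n).1 + s) T) ω - Z p (min (p.1 + s) T) ω‖ₑ ∂Q) atTop (𝓝 0)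

/-- Convergence in probability of the truncated entry times:
`Q(|τ^{tₙ,zₙ} ∧ 2T - τ^{t,z} ∧ 2T| > ε) → 0` for all `ε > 0`. -/
def EntryTimesConverge {_ : MeasurableSpace Ω} {d : ℕ} (T : ℝ) (Q : Measure Ω)
    (D : Set (ℝ × Eucl d)) (Z : ℝ × Eucl d → ℝ → Ω → Eucl d) (q : ℕ → ℝ × Eucl d)
    (p : ℝ × Eucl d) : Prop :=
  ∀ ε : ℝ, 0 < ε → Tendsto
    (fun n => Q {ω | ε < |(min (entryTime T D (q n).1 (Z (q n)) ω) ((2 * T : ℝ) : EReal)).toReal -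
      (min (entryTime T D p.1 (Z p) ω) ((2 * T : ℝ) : EReal)).toReal|}) atTop (𝓝 0)

/-- For non-negative `f` and `g`, the function
`u(t, z) = E[exp(-½ ∫ₜᵀ f(s, Z_s) ds - ½ g(Z_T)) 1_{T < τ}]` with `Z = Z^{t,z}`, where the
exponential is zero if the time integral is infinite. -/
def killedExpectation {_ : MeasurableSpace Ω} {d : ℕ} (T : ℝ) (Q : Measure Ω)
    (D : Set (ℝ × Eucl d)) (Z : ℝ × Eucl d → ℝ → Ω → Eucl d) (f : ℝ × Eucl d → ℝ)
    (g : Eucl d → ℝ) (p : ℝ × Eucl d) : ℝ :=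
  (∫⁻ ω, {ω | (T : EReal) < entryTime T D p.1 (Z p) ω}.indicator
    (fun ω => EReal.exp (-((((∫⁻ s in Icc p.1 T, ENNReal.ofReal (f (s, Z p s ω))) +
      ENNReal.ofReal (g (Z p T ω))) / 2 : ℝ≥0∞) : EReal))) ω ∂Q).toReal

end KilledDiffusion

end

open MeasureTheory ProbabilityTheory Filter Topology Set
open scoped ENNReal

noncomputable section

namespace KilledDiffusion

variable {Ω : Type*}

/-! The target lies at the single time `t₀`, so the entry time takes only two values: `t₀` if the
path starts no later than `t₀` and lies in `closure A` at time `t₀`, and `∞` otherwise. Both claims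
thus reduce to the convergence of the indicator of `hitEvent`.

By `L¹` continuity of the flow, every subsequence has a further one along which the time-shifted
paths converge uniformly, almost surely (`RegularFlow.exists_subseq`), hence also at the fixed time
`t₀` (`RegularFlow.tendsto_clampedPath`). The indicator is then eventually equal to its limit,
except when the limit position is on the frontier, or when the limit path hits while approximating
paths start after `t₀` (`StableHit.eventually_mem_iff`). For a start before `t₀` the frontier is
excluded by hypothesis. For a start at `t₀` the position is the initial point: outside `closure A`
in (i), inside the open set `A` in (ii), where the times approach from the left.

For `u`, the running cost converges along the same paths and the integrand is at most `1`, so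
dominated convergence applies. -/

/-- A family of `ℝ≥0∞`-valued functions whose integrals tend to zero has a subsequence that tends
to zero almost everywhere. -/
lemma exists_subseq_ae_tendsto_zero {mΩ : MeasurableSpace Ω} {Q : Measure Ω}
    {F : ℕ → Ω → ℝ≥0∞} (hF : ∀ n, AEMeasurable (F n) Q)
    (h : Tendsto (fun n => ∫⁻ ω, F n ω ∂Q) atTop (𝓝 0)) :
    ∃ ms : ℕ → ℕ, StrictMono ms ∧ ∀ᵐ ω ∂Q, Tendsto (fun k => F (ms k) ω) atTop (𝓝 0) := by
  have hev : ∀ k : ℕ, ∀ᶠ n in atTop, ∫⁻ ω, F n ω ∂Q < (2⁻¹ : ℝ≥0∞) ^ k := fun k =>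
    h.eventually (gt_mem_nhds (ENNReal.pow_pos (by simp) k))
  obtain ⟨ms, hms, hlt⟩ := extraction_forall_of_eventually hev
  refine ⟨ms, hms, ?_⟩
  have hsum : ∫⁻ ω, ∑' k, F (ms k) ω ∂Q ≠ ∞ := by
    rw [lintegral_tsum fun k => hF (ms k)]
    refine ne_top_of_le_ne_top ?_ (ENNReal.tsum_le_tsum fun k => (hlt k).le)
    rw [ENNReal.tsum_geometric]
    simp
  filter_upwards [ae_lt_top' (AEMeasurable.tsum fun k => hF (ms k)) hsum] with ω hω
  exact ENNReal.tendsto_atTop_zero_of_tsum_ne_top hω.ne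

/-! ### Measurability and path regularity of the flow -/

/-- The augmentation adds null sets that need not be measurable in the original space, so
adaptedness yields null measurability only. -/
lemma augmentedFiltration_le {mΩ : MeasurableSpace Ω} {n : ℕ} {T : ℝ} {Q : Measure Ω}
    {𝒢 : Filtration ℝ mΩ} {W : ℝ → Ω → Eucl n} (hW : IsBrownianMotion T Q 𝒢 W) {s : ℝ}
    (hs : s ≤ T) :
    augmentedFiltration Q W s ≤ NullMeasurableSpace.instMeasurableSpace (μ := Q) := by
  refine sup_le (iSup₂_le fun r hr => ?_) (MeasurableSpace.generateFrom_le fun N hN => ?_)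
  · have hm : Measurable (W r) :=
      (hW.adapted r ⟨hr.1, hr.2.trans hs⟩).mono (𝒢.le r) le_rfl
    rintro _ ⟨B, hB, rfl⟩
    exact (hm hB).nullMeasurableSet
  · exact NullMeasurableSet.of_null hN

/-- The path started at `p`, extended from `[p.1, T]` to `ℝ` by freezing its end values. -/
def clampedPath {E : Type*} (T : ℝ) (Z : ℝ × E → ℝ → Ω → E) (p : ℝ × E) (r : ℝ) (ω : Ω) : E :=
  Z p (max p.1 (min r T)) ω

lemma clamp_mem {a T r : ℝ} (ha : a ≤ T) : max a (min r T) ∈ Icc a T :=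
  ⟨le_max_left _ _, max_le ha (min_le_right _ _)⟩

/-- The flow has continuous paths and is measurable up to null sets. -/
structure RegularFlow {mΩ : MeasurableSpace Ω} {d : ℕ} (T : ℝ) (Q : Measure Ω)
    (Z : ℝ × Eucl d → ℝ → Ω → Eucl d) : Prop where
  continuous_clamped : ∀ p ∈ stateSpace d T, ∀ ω, Continuous fun r => clampedPath T Z p r ω
  nullMeasurable : ∀ p ∈ stateSpace d T, ∀ r, NullMeasurable (clampedPath T Z p r) Q
  initial : ∀ p ∈ stateSpace d T, ∀ᵐ ω ∂Q, Z p p.1 ω = p.2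

lemma regularFlow_of_isStrongSolution {mΩ : MeasurableSpace Ω} {d d' : ℕ} {T : ℝ}
    {μ : ℝ × Eucl d → Eucl d} {σ : ℝ × Eucl d → Matrix (Fin d) (Fin d') ℝ} {Q : Measure Ω}
    {𝒢 : Filtration ℝ mΩ} {W : ℝ → Ω → Eucl d'} (hW : IsBrownianMotion T Q 𝒢 W)
    {Z : ℝ × Eucl d → ℝ → Ω → Eucl d}
    (hZ : ∀ p ∈ stateSpace d T, IsStrongSolution T μ σ Q W p (Z p)) : RegularFlow T Q Z where
  continuous_clamped p hp ω := by
    refine ((hZ p hp).continuous_paths ω).comp_continuous (by fun_prop) fun r => ?_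
    exact clamp_mem hp.1.2
  nullMeasurable p hp r := by
    have hmem := clamp_mem (r := r) hp.1.2
    exact ((hZ p hp).adapted _ hmem).mono (augmentedFiltration_le hW hmem.2) le_rfl
  initial p hp := (hZ p hp).initial

/-! ### Pathwise convergence of the flow -/

section Flow

variable {mΩ : MeasurableSpace Ω} {d : ℕ} {T : ℝ} {Q : Measure Ω}
  {Z : ℝ × Eucl d → ℝ → Ω → Eucl d}

lemma clampedPath_eq {p : ℝ × Eucl d} {r : ℝ} (hr : r ∈ Icc p.1 T) (ω : Ω) :
    clampedPath T Z p r ω = Z p r ω := by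
  simp [clampedPath, min_eq_left hr.2, max_eq_right hr.1]

lemma clampedPath_shift {p : ℝ × Eucl d} (hp : p ∈ stateSpace d T) {s : ℝ} (hs : 0 ≤ s) (ω : Ω) :
    clampedPath T Z p (p.1 + s) ω = Z p (min (p.1 + s) T) ω := by
  have h : p.1 ≤ min (p.1 + s) T := le_min (by linarith) hp.1.2
  simp [clampedPath, max_eq_right h]

/-- The uniform distance on `[0, T]` of the time-shifted paths started at `q` and `p`. -/
def flowDist (T : ℝ) (Z : ℝ × Eucl d → ℝ → Ω → Eucl d) (q p : ℝ × Eucl d) (ω : Ω) : ℝ≥0∞ :=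
  ⨆ s ∈ Icc 0 T, ‖clampedPath T Z q (q.1 + s) ω - clampedPath T Z p (p.1 + s) ω‖ₑ

/-- By continuity a countable supremum suffices; this makes `flowDist` measurable up to null sets.
-/
lemma biSup_enorm_eq_of_dense {E : Type*} [NormedAddCommGroup E] {S : Set ℝ} {φ : ℝ → E}
    (hφ : Continuous φ) {u : ℕ → S} (hu : DenseRange u) :
    ⨆ s ∈ S, ‖φ s‖ₑ = ⨆ k, ‖φ (u k)‖ₑ := by
  refine le_antisymm (iSup₂_le fun s hs => ?_)
    (iSup_le fun k => le_iSup₂_of_le _ (u k).2 le_rfl)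
  have hcl : IsClosed {x : S | ‖φ x‖ₑ ≤ ⨆ k, ‖φ (u k)‖ₑ} :=
    isClosed_le (by fun_prop) continuous_const
  have := hu.induction_on (p := fun x : S => ‖φ x‖ₑ ≤ ⨆ k, ‖φ (u k)‖ₑ) ⟨s, hs⟩ hcl
    fun k => le_iSup (fun k => ‖φ (u k)‖ₑ) k
  exact this

lemma RegularFlow.aemeasurable_flowDist (hR : RegularFlow T Q Z) {q p : ℝ × Eucl d}
    (hq : q ∈ stateSpace d T) (hp : p ∈ stateSpace d T) : AEMeasurable (flowDist T Z q p) Q := by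
  have : Nonempty (Icc 0 T) := ⟨⟨0, le_rfl, hp.1.1.trans hp.1.2⟩⟩
  have heq : flowDist T Z q p = fun ω => ⨆ k, ‖clampedPath T Z q
      (q.1 + TopologicalSpace.denseSeq (Icc 0 T) k) ω -
        clampedPath T Z p (p.1 + TopologicalSpace.denseSeq (Icc 0 T) k) ω‖ₑ := by
    funext ω
    refine biSup_enorm_eq_of_dense (φ := fun s => clampedPath T Z q (q.1 + s) ω -
      clampedPath T Z p (p.1 + s) ω) ?_ (TopologicalSpace.denseRange_denseSeq _)
    exact ((hR.continuous_clamped q hq ω).comp (by fun_prop)).sub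
      ((hR.continuous_clamped p hp ω).comp (by fun_prop))
  rw [heq]
  exact AEMeasurable.iSup fun k =>
    ((hR.nullMeasurable q hq _).aemeasurable.sub (hR.nullMeasurable p hp _).aemeasurable).enorm

/-- Along a subsequence the time-shifted paths converge uniformly, almost surely. -/
lemma RegularFlow.exists_subseq (hR : RegularFlow T Q Z) (hZ : FlowContinuous T Q Z) (hT : 0 < T)
    {q : ℕ → ℝ × Eucl d} {p : ℝ × Eucl d} (hq : ∀ n, q n ∈ stateSpace d T)
    (hp : p ∈ stateSpace d T) (hqp : Tendsto q atTop (𝓝 p)) :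
    ∃ ms : ℕ → ℕ, StrictMono ms ∧
      ∀ᵐ ω ∂Q, Tendsto (fun k => flowDist T Z (q (ms k)) p ω) atTop (𝓝 0) := by
  refine exists_subseq_ae_tendsto_zero (fun n => hR.aemeasurable_flowDist (hq n) hp) ?_
  refine (hZ T hT q p hq hp hqp).congr fun n => lintegral_congr fun ω => ?_
  refine iSup_congr fun s => iSup_congr fun hs => ?_
  rw [clampedPath_shift (hq n) hs.1, clampedPath_shift hp hs.1]

/-- Passes from elapsed to absolute time: at time `r` the path from `q` has run for `max (r - q.1)
0`. -/
lemma enorm_sub_le_flowDist {q p : ℝ × Eucl d} (hq : q ∈ stateSpace d T) {r : ℝ}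
    (hr : r ∈ Icc 0 T) (ω : Ω) :
    ‖clampedPath T Z q r ω - clampedPath T Z p (p.1 + max (r - q.1) 0) ω‖ₑ ≤
      flowDist T Z q p ω := by
  have hs : max (r - q.1) 0 ∈ Icc 0 T :=
    ⟨le_max_right _ _, max_le (by linarith [hr.2, hq.1.1]) (hr.1.trans hr.2)⟩
  have h : clampedPath T Z q r ω = clampedPath T Z q (q.1 + max (r - q.1) 0) ω := by
    unfold clampedPath
    congr 1
    rw [min_eq_left hr.2]
    rcases le_total r q.1 with h | h
    · simp [h, hq.1.2]
    · simp [h, hr.2]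
  rw [h]
  exact le_iSup₂ (f := fun s (_ : s ∈ Icc 0 T) =>
    ‖clampedPath T Z q (q.1 + s) ω - clampedPath T Z p (p.1 + s) ω‖ₑ) _ hs

/-- The error splits into the uniform distance of the shifted paths and a time shift of the limit
path, which vanishes by continuity. -/
lemma RegularFlow.tendsto_clampedPath (hR : RegularFlow T Q Z) {q : ℕ → ℝ × Eucl d}
    {p : ℝ × Eucl d} (hq : ∀ n, q n ∈ stateSpace d T) (hp : p ∈ stateSpace d T)
    (hqp : Tendsto q atTop (𝓝 p)) {ω : Ω}
    (hω : Tendsto (fun n => flowDist T Z (q n) p ω) atTop (𝓝 0)) {r : ℝ} (hr : r ∈ Icc 0 T) :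
    Tendsto (fun n => clampedPath T Z (q n) r ω) atTop (𝓝 (clampedPath T Z p r ω)) := by
  have h1 : Tendsto (fun n => clampedPath T Z (q n) r ω -
      clampedPath T Z p (p.1 + max (r - (q n).1) 0) ω) atTop (𝓝 0) := by
    rw [tendsto_zero_iff_enorm_tendsto_zero]
    exact tendsto_of_tendsto_of_tendsto_of_le_of_le tendsto_const_nhds hω (fun _ => zero_le)
      fun n => enorm_sub_le_flowDist (hq n) hr ω
  have h2 : Tendsto (fun n => clampedPath T Z p (p.1 + max (r - (q n).1) 0) ω) atTop
      (𝓝 (clampedPath T Z p (p.1 + max (r - p.1) 0) ω)) := by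
    have hc : Continuous fun a : ℝ => clampedPath T Z p (p.1 + max (r - a) 0) ω :=
      (hR.continuous_clamped p hp ω).comp (by fun_prop)
    exact (hc.tendsto p.1).comp ((continuous_fst.tendsto p).comp hqp)
  have h3 : clampedPath T Z p (p.1 + max (r - p.1) 0) ω = clampedPath T Z p r ω := by
    unfold clampedPath
    congr 1
    rw [min_eq_left hr.2]
    rcases le_total r p.1 with h | h
    · simp [h, hp.1.2]
    · simp [h, hr.2]
  simpa [h3] using h1.add h2

lemma RegularFlow.eventually_norm_le (hR : RegularFlow T Q Z) {q : ℕ → ℝ × Eucl d}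
    {p : ℝ × Eucl d} (hq : ∀ n, q n ∈ stateSpace d T) (hp : p ∈ stateSpace d T) {ω : Ω}
    (hω : Tendsto (fun n => flowDist T Z (q n) p ω) atTop (𝓝 0)) :
    ∃ R : ℝ, ∀ᶠ n in atTop, ∀ r ∈ Icc 0 T, ‖clampedPath T Z (q n) r ω‖ ≤ R := by
  -- The start and the elapsed time are each at most `T`, so their sum stays in `[0, 2T]`.
  obtain ⟨K, hK⟩ := (isCompact_Icc (a := (0 : ℝ)) (b := 2 * T)).exists_bound_of_continuousOn
    (hR.continuous_clamped p hp ω).continuousOn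
  refine ⟨1 + K, ?_⟩
  filter_upwards [hω.eventually (gt_mem_nhds zero_lt_one)] with n hn r hr
  have h1 := (enorm_sub_le_flowDist (Z := Z) (p := p) (hq n) hr ω).trans hn.le
  have h2 : ‖clampedPath T Z (q n) r ω -
      clampedPath T Z p (p.1 + max (r - (q n).1) 0) ω‖ ≤ 1 := by
    rw [← ofReal_norm, ← ENNReal.ofReal_one] at h1
    exact (ENNReal.ofReal_le_ofReal_iff zero_le_one).1 h1
  have h3 := hK (p.1 + max (r - (q n).1) 0)
    ⟨add_nonneg hp.1.1 (le_max_right _ _), by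
      have : max (r - (q n).1) 0 ≤ T := max_le (by linarith [hr.2, (hq n).1.1]) (hr.1.trans hr.2)
      linarith [hp.1.2]⟩
  calc _ = ‖(clampedPath T Z (q n) r ω - clampedPath T Z p (p.1 + max (r - (q n).1) 0) ω) +
        clampedPath T Z p (p.1 + max (r - (q n).1) 0) ω‖ := by rw [sub_add_cancel]
    _ ≤ 1 + K := (norm_add_le _ _).trans (add_le_add h2 h3)

/-! ### Stability of the hitting event -/

/-- The event that the process started at `p` hits `{t₀} × closure A`. -/
def hitEvent (T : ℝ) (Z : ℝ × Eucl d → ℝ → Ω → Eucl d) (t₀ : ℝ) (A : Set (Eucl d))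
    (p : ℝ × Eucl d) : Set Ω :=
  {ω | p.1 ≤ t₀ ∧ clampedPath T Z p t₀ ω ∈ closure A}

variable {t₀ : ℝ} {A : Set (Eucl d)}

open scoped Classical in
lemma entryTime_eq (ht₀ : t₀ ≤ T) (p : ℝ × Eucl d) (ω : Ω) :
    entryTime T ({t₀} ×ˢ closure A) p.1 (Z p) ω =
      if ω ∈ hitEvent T Z t₀ A p then (t₀ : EReal) else ⊤ := by
  unfold entryTime
  split_ifs with h
  · have hset : {s | s ∈ Icc p.1 T ∧ (s, Z p s ω) ∈ ({t₀} ×ˢ closure A : Set (ℝ × Eucl d))} =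
        {t₀} := by
      ext s
      simp only [mem_ofPred_eq, mem_prod, mem_singleton_iff]
      constructor
      · exact fun hs => hs.2.1
      · rintro rfl
        exact ⟨⟨h.1, ht₀⟩, rfl, by simpa only [clampedPath_eq ⟨h.1, ht₀⟩] using h.2⟩
    rw [hset, image_singleton, sInf_singleton]
  · have hset : {s | s ∈ Icc p.1 T ∧ (s, Z p s ω) ∈ ({t₀} ×ˢ closure A : Set (ℝ × Eucl d))} =
        ∅ := by
      ext s
      simp only [mem_ofPred_eq, mem_prod, mem_singleton_iff, mem_empty_iff_false, iff_false]
      rintro ⟨hs, rfl, hA⟩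
      exact h ⟨hs.1, by simpa only [clampedPath_eq hs] using hA⟩
    rw [hset, image_empty, sInf_empty]

open scoped Classical in
lemma toReal_min_entryTime (hT : 0 < T) (ht₀ : t₀ ≤ T) (p : ℝ × Eucl d) (ω : Ω) :
    (min (entryTime T ({t₀} ×ˢ closure A) p.1 (Z p) ω) ((2 * T : ℝ) : EReal)).toReal =
      if ω ∈ hitEvent T Z t₀ A p then t₀ else 2 * T := by
  rw [entryTime_eq ht₀]
  split_ifs with h
  · rw [min_eq_left (EReal.coe_le_coe_iff.2 (by linarith)), EReal.toReal_coe]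
  · rw [min_eq_right le_top, EReal.toReal_coe]

lemma lt_entryTime_iff (ht₀ : t₀ ≤ T) (p : ℝ × Eucl d) (ω : Ω) :
    (T : EReal) < entryTime T ({t₀} ×ˢ closure A) p.1 (Z p) ω ↔ ω ∉ hitEvent T Z t₀ A p := by
  rw [entryTime_eq ht₀]
  split_ifs with h
  · simpa [h] using ht₀
  · simp [h]

lemma RegularFlow.nullMeasurableSet_hitEvent (hR : RegularFlow T Q Z) {p : ℝ × Eucl d}
    (hp : p ∈ stateSpace d T) : NullMeasurableSet (hitEvent T Z t₀ A p) Q :=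
  (NullMeasurableSet.const _).inter (hR.nullMeasurable p hp t₀ isClosed_closure.measurableSet)

/-- The condition on the limit path under which the hitting events of processes started at
`q n → p` converge. -/
def StableHit (T : ℝ) (Z : ℝ × Eucl d → ℝ → Ω → Eucl d) (t₀ : ℝ) (A : Set (Eucl d))
    (q : ℕ → ℝ × Eucl d) (p : ℝ × Eucl d) (ω : Ω) : Prop :=
  t₀ < p.1 ∨ clampedPath T Z p t₀ ω ∉ closure A ∨
    ((∀ᶠ n in atTop, (q n).1 ≤ t₀) ∧ clampedPath T Z p t₀ ω ∉ frontier A)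

lemma StableHit.comp {q : ℕ → ℝ × Eucl d} {p : ℝ × Eucl d} {ω : Ω}
    (h : StableHit T Z t₀ A q p ω) {ns : ℕ → ℕ} (hns : Tendsto ns atTop atTop) :
    StableHit T Z t₀ A (q ∘ ns) p ω := by
  rcases h with h | h | ⟨h1, h2⟩
  exacts [.inl h, .inr (.inl h), .inr (.inr ⟨hns.eventually h1, h2⟩)]

lemma StableHit.eventually_mem_iff (hA : IsOpen A) {q : ℕ → ℝ × Eucl d} {p : ℝ × Eucl d}
    (hqp : Tendsto q atTop (𝓝 p)) {ω : Ω} (h : StableHit T Z t₀ A q p ω)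
    (hX : Tendsto (fun n => clampedPath T Z (q n) t₀ ω) atTop (𝓝 (clampedPath T Z p t₀ ω))) :
    ∀ᶠ n in atTop, (ω ∈ hitEvent T Z t₀ A (q n) ↔ ω ∈ hitEvent T Z t₀ A p) := by
  have hq1 : Tendsto (fun n => (q n).1) atTop (𝓝 p.1) := (continuous_fst.tendsto p).comp hqp
  -- Outside the closed set no control of the start times is needed: nearby positions are outside
  -- too, which already excludes a hit.
  have hout : clampedPath T Z p t₀ ω ∉ closure A →
      ∀ᶠ n in atTop, (ω ∈ hitEvent T Z t₀ A (q n) ↔ ω ∈ hitEvent T Z t₀ A p) := fun hc => by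
    filter_upwards [hX.eventually (isClosed_closure.isOpen_compl.mem_nhds hc)] with n hn
    exact iff_of_false (fun h' => hn h'.2) fun h' => hc h'.2
  rcases h with h | h | ⟨hev, hfr⟩
  · filter_upwards [hq1.eventually (lt_mem_nhds h)] with n hn
    exact iff_of_false (fun h' => hn.not_ge h'.1) fun h' => h.not_ge h'.1
  · exact hout h
  · by_cases hc : clampedPath T Z p t₀ ω ∈ closure A
    · have hmem : clampedPath T Z p t₀ ω ∈ A := by
        by_contra hnot
        exact hfr ⟨hc, by rwa [hA.interior_eq]⟩
      filter_upwards [hev, hX.eventually (hA.mem_nhds hmem)] with n h1 h2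
      exact iff_of_true ⟨h1, subset_closure h2⟩ ⟨le_of_tendsto hq1 hev, hc⟩
    · exact hout hc

/-- The three alternatives of `StableHit` match a start before `t₀` (null frontier), at `t₀`
(initial point outside the closure) and after `t₀`. -/
lemma RegularFlow.stableHit_of_mem_compl (hR : RegularFlow T Q Z) (ht₀ : t₀ ≤ T)
    (hnull : ∀ t ∈ Ico 0 t₀, ∀ z : Eucl d, Q {ω | Z (t, z) t₀ ω ∈ frontier A} = 0)
    {q : ℕ → ℝ × Eucl d} {p : ℝ × Eucl d} (hp : p ∈ stateSpace d T \ {t₀} ×ˢ closure A)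
    (hqp : Tendsto q atTop (𝓝 p)) : ∀ᵐ ω ∂Q, StableHit T Z t₀ A q p ω := by
  have hq1 : Tendsto (fun n => (q n).1) atTop (𝓝 p.1) := (continuous_fst.tendsto p).comp hqp
  rcases lt_trichotomy p.1 t₀ with h | h | h
  · have hae : ∀ᵐ ω ∂Q, Z p t₀ ω ∉ frontier A := by
      rw [ae_iff]
      simpa using hnull p.1 ⟨hp.1.1.1, h⟩ p.2
    filter_upwards [hae] with ω hω
    refine .inr (.inr ⟨hq1.eventually (ge_mem_nhds h), ?_⟩)
    rwa [clampedPath_eq ⟨h.le, ht₀⟩]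
  · filter_upwards [hR.initial p hp.1] with ω hω
    refine .inr (.inl ?_)
    rw [clampedPath_eq ⟨h.le, ht₀⟩, ← h, hω]
    exact fun hc => hp.2 ⟨h, hc⟩
  · exact .of_forall fun ω => .inl h

lemma RegularFlow.stableHit_of_mem (hR : RegularFlow T Q Z) (ht₀ : t₀ ∈ Ioc 0 T) (hA : IsOpen A)
    {q : ℕ → ℝ × Eucl d} {z : Eucl d} (hz : z ∈ A) (hq : ∀ n, (q n).1 ≤ t₀) :
    ∀ᵐ ω ∂Q, StableHit T Z t₀ A q (t₀, z) ω := by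
  filter_upwards [hR.initial (t₀, z) ⟨⟨ht₀.1.le, ht₀.2⟩, trivial⟩] with ω hω
  refine .inr (.inr ⟨.of_forall hq, ?_⟩)
  rw [clampedPath_eq (p := (t₀, z)) ⟨le_rfl, ht₀.2⟩]
  rw [show Z (t₀, z) t₀ ω = z from hω, hA.frontier_eq]
  exact fun h => h.2 hz

/-! ### Convergence of the entry times -/

lemma RegularFlow.entryTimesConverge [IsFiniteMeasure Q] (hR : RegularFlow T Q Z)
    (hZ : FlowContinuous T Q Z) (ht₀ : t₀ ∈ Ioc 0 T) (hA : IsOpen A)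
    {q : ℕ → ℝ × Eucl d} {p : ℝ × Eucl d} (hq : ∀ n, q n ∈ stateSpace d T)
    (hp : p ∈ stateSpace d T) (hqp : Tendsto q atTop (𝓝 p))
    (hst : ∀ᵐ ω ∂Q, StableHit T Z t₀ A q p ω) :
    EntryTimesConverge T Q ({t₀} ×ˢ closure A) Z q p := by
  classical
  have hT : 0 < T := ht₀.1.trans_le ht₀.2
  intro ε hε
  simp only [toReal_min_entryTime hT ht₀.2]
  set v : ℝ × Eucl d → Ω → ℝ := fun p ω => if ω ∈ hitEvent T Z t₀ A p then t₀ else 2 * T with hv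
  have hvm : ∀ p ∈ stateSpace d T, AEStronglyMeasurable (v p) Q := fun p hp => by
    have hm : NullMeasurable (v p) Q :=
      Measurable.ite (α := NullMeasurableSpace Ω Q) (hR.nullMeasurableSet_hitEvent hp)
        measurable_const measurable_const
    exact hm.aemeasurable.aestronglyMeasurable
  -- Almost sure convergence is available only along subsequences, which is enough for a limit of
  -- real or extended numbers.
  refine tendsto_of_subseq_tendsto fun ns hns => ?_
  obtain ⟨ms, hms, hae⟩ := hR.exists_subseq hZ hT (q := q ∘ ns) (fun n => hq _) hp (hqp.comp hns)
  have hsub := hns.comp hms.tendsto_atTop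
  have hlim : TendstoInMeasure Q (fun k => v (q (ns (ms k)))) atTop (v p) := by
    refine tendstoInMeasure_of_tendsto_ae (fun k => hvm _ (hq _)) ?_
    filter_upwards [hae, hst] with ω hω hs
    have hX := hR.tendsto_clampedPath (q := q ∘ ns ∘ ms) (fun n => hq _) hp (hqp.comp hsub) hω
      ⟨ht₀.1.le, ht₀.2⟩
    refine tendsto_const_nhds.congr' ?_
    filter_upwards [(hs.comp hsub).eventually_mem_iff hA (hqp.comp hsub) hX] with n hn
    simp only [hv]
    exact if_congr hn.symm rfl rfl
  refine ⟨ms, tendsto_of_tendsto_of_tendsto_of_le_of_le tendsto_const_nhds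
    (tendstoInMeasure_iff_dist.1 hlim ε hε) (fun _ => zero_le) fun k => measure_mono fun ω hω => ?_⟩
  exact le_of_lt (show ε < dist (v (q (ns (ms k))) ω) (v p ω) from hω)

/-! ### Convergence of the running cost -/

/-- The time integral `∫ₜᵀ f(s, Z_s) ds`. -/
def runningCost (T : ℝ) (Z : ℝ × Eucl d → ℝ → Ω → Eucl d) (f : ℝ × Eucl d → ℝ)
    (p : ℝ × Eucl d) (ω : Ω) : ℝ≥0∞ :=
  ∫⁻ s in Icc p.1 T, ENNReal.ofReal (f (s, Z p s ω))

variable {f : ℝ × Eucl d → ℝ} {g : Eucl d → ℝ}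

lemma continuous_comp_clamp (hT : 0 ≤ T) (hf : ContinuousOn f (stateSpace d T)) :
    Continuous fun x : ℝ × Eucl d => f (max 0 (min x.1 T), x.2) :=
  hf.comp_continuous (by fun_prop) fun _ => ⟨clamp_mem hT, trivial⟩

lemma runningCost_eq {p : ℝ × Eucl d} (hp : p ∈ stateSpace d T) (ω : Ω) :
    runningCost T Z f p ω = ∫⁻ s in Icc p.1 T,
      ENNReal.ofReal (f (max 0 (min s T), clampedPath T Z p s ω)) := by
  refine setLIntegral_congr_fun measurableSet_Icc fun s hs => ?_
  simp only [clampedPath_eq hs, min_eq_left hs.2, max_eq_right (hp.1.1.trans hs.1)]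

/-- Moves the variable start time into the integrand, so that dominated convergence runs over a
fixed interval. -/
lemma runningCost_eq_indicator {p : ℝ × Eucl d} (hp : p ∈ stateSpace d T) (ω : Ω) :
    runningCost T Z f p ω = ∫⁻ s in Icc 0 T, (Ici p.1).indicator
      (fun s => ENNReal.ofReal (f (max 0 (min s T), clampedPath T Z p s ω))) s := by
  rw [runningCost_eq hp, setLIntegral_indicator measurableSet_Ici]
  congr 2
  ext s
  exact ⟨fun h => ⟨h.1, hp.1.1.trans h.1, h.2⟩, fun h => ⟨h.1, h.2.2⟩⟩

lemma RegularFlow.aemeasurable_runningCost (hR : RegularFlow T Q Z)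
    (hf : ContinuousOn f (stateSpace d T)) {p : ℝ × Eucl d} (hp : p ∈ stateSpace d T) :
    AEMeasurable (runningCost T Z f p) Q := by
  have hT : 0 ≤ T := hp.1.1.trans hp.1.2
  have hpath : Measurable (Function.uncurry fun (s : ℝ) (ω : NullMeasurableSpace Ω Q) =>
      clampedPath T Z p s ω) :=
    measurable_uncurry_of_continuous_of_measurable (hR.continuous_clamped p hp)
      (hR.nullMeasurable p hp)
  have hint : Measurable fun x : ℝ × NullMeasurableSpace Ω Q =>
      ENNReal.ofReal (f (max 0 (min x.1 T), clampedPath T Z p x.1 x.2)) :=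
    ENNReal.measurable_ofReal.comp
      ((continuous_comp_clamp hT hf).measurable.comp (measurable_fst.prodMk hpath))
  have hm : NullMeasurable (runningCost T Z f p) Q := by
    rw [show runningCost T Z f p = _ from funext fun ω => runningCost_eq hp ω]
    exact hint.lintegral_prod_left' (μ := volume.restrict (Icc p.1 T))
  exact hm.aemeasurable

/-- The paths eventually stay in a common ball, so `f` is bounded along them by compactness; this
constant is the dominating function. -/
lemma RegularFlow.tendsto_runningCost (hR : RegularFlow T Q Z)
    (hf : ContinuousOn f (stateSpace d T)) {q : ℕ → ℝ × Eucl d}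
    {p : ℝ × Eucl d} (hq : ∀ n, q n ∈ stateSpace d T) (hp : p ∈ stateSpace d T)
    (hqp : Tendsto q atTop (𝓝 p)) {ω : Ω}
    (hω : Tendsto (fun n => flowDist T Z (q n) p ω) atTop (𝓝 0)) :
    Tendsto (fun n => runningCost T Z f (q n) ω) atTop (𝓝 (runningCost T Z f p ω)) := by
  have hT : 0 ≤ T := hp.1.1.trans hp.1.2
  have hq1 : Tendsto (fun n => (q n).1) atTop (𝓝 p.1) := (continuous_fst.tendsto p).comp hqp
  have hfc := continuous_comp_clamp hT hf
  obtain ⟨R, hRb⟩ := hR.eventually_norm_le hq hp hω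
  obtain ⟨K, hK⟩ := ((isCompact_Icc (a := (0 : ℝ)) (b := T)).prod
    (isCompact_closedBall (0 : Eucl d) R)).exists_bound_of_continuousOn hfc.continuousOn
  simp only [runningCost_eq_indicator hp, runningCost_eq_indicator (hq _)]
  refine tendsto_lintegral_filter_of_dominated_convergence (fun _ => ENNReal.ofReal K)
    (.of_forall fun n => ?_) ?_ ?_ ?_
  · exact (ENNReal.measurable_ofReal.comp (hfc.comp (continuous_id.prodMk
      (hR.continuous_clamped _ (hq n) ω))).measurable).indicator measurableSet_Ici
  · filter_upwards [hRb] with n hn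
    filter_upwards [ae_restrict_mem measurableSet_Icc] with s hs
    refine (indicator_le_self _ _ _).trans (ENNReal.ofReal_le_ofReal ((le_abs_self _).trans ?_))
    exact hK (s, clampedPath T Z (q n) s ω) ⟨hs, by simpa using hn s hs⟩
  · simp [ENNReal.mul_eq_top]
  -- The indicators of `[tₙ, ∞)` may fail to converge only at `s = p.1`, a null set.
  · filter_upwards [ae_restrict_mem measurableSet_Icc,
      (measure_eq_zero_iff_ae_notMem.1 (measure_singleton p.1) :
        ∀ᵐ s ∂volume.restrict (Icc 0 T), s ∉ ({p.1} : Set ℝ))] with s hs hsp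
    have hlim : Tendsto (fun n => ENNReal.ofReal
        (f (max 0 (min s T), clampedPath T Z (q n) s ω))) atTop
        (𝓝 (ENNReal.ofReal (f (max 0 (min s T), clampedPath T Z p s ω)))) :=
      ((ENNReal.continuous_ofReal.comp hfc).tendsto (s, clampedPath T Z p s ω)).comp
        (tendsto_const_nhds.prodMk_nhds (hR.tendsto_clampedPath hq hp hqp hω hs))
    rcases lt_or_gt_of_ne hsp with h | h
    · refine tendsto_nhds_of_eventually_eq ?_
      filter_upwards [hq1.eventually (lt_mem_nhds h)] with n hn
      rw [indicator_of_notMem (show s ∉ Ici (q n).1 from notMem_Ici.2 hn),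
        indicator_of_notMem (show s ∉ Ici p.1 from notMem_Ici.2 h)]
    · rw [indicator_of_mem (show s ∈ Ici p.1 from h.le)]
      refine hlim.congr' ?_
      filter_upwards [hq1.eventually (gt_mem_nhds h)] with n hn
      rw [indicator_of_mem (show s ∈ Ici (q n).1 from hn.le)]

/-! ### Continuity of the killed expectation -/

/-- The function `r ↦ e^{-r/2}` on `[0, ∞]`. -/
def expNegHalf (r : ℝ≥0∞) : ℝ≥0∞ := EReal.exp (-((r / 2 : ℝ≥0∞) : EReal))

lemma continuous_expNegHalf : Continuous expNegHalf :=
  ENNReal.continuous_exp.comp (continuous_neg.comp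
    (continuous_coe_ennreal_ereal.comp (ENNReal.continuous_div_const 2 two_ne_zero)))

lemma expNegHalf_le_one (r : ℝ≥0∞) : expNegHalf r ≤ 1 := by
  rw [expNegHalf, EReal.exp_le_one_iff, EReal.neg_le, neg_zero]
  exact EReal.coe_ennreal_nonneg _

lemma killedExpectation_eq (ht₀ : t₀ ≤ T) {p : ℝ × Eucl d} (hp : p ∈ stateSpace d T) :
    killedExpectation T Q ({t₀} ×ˢ closure A) Z f g p =
      (∫⁻ ω, (hitEvent T Z t₀ A p)ᶜ.indicator (fun ω => expNegHalf (runningCost T Z f p ω +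
        ENNReal.ofReal (g (clampedPath T Z p T ω)))) ω ∂Q).toReal := by
  have hset : {ω | (T : EReal) < entryTime T ({t₀} ×ˢ closure A) p.1 (Z p) ω} =
      (hitEvent T Z t₀ A p)ᶜ := by
    ext ω
    exact lt_entryTime_iff ht₀ p ω
  rw [killedExpectation, hset]
  simp only [clampedPath_eq (right_mem_Icc.2 hp.1.2)]
  rfl

lemma RegularFlow.tendsto_killedExpectation [IsFiniteMeasure Q] (hR : RegularFlow T Q Z)
    (hZ : FlowContinuous T Q Z) (ht₀ : t₀ ∈ Ioc 0 T) (hA : IsOpen A)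
    (hf : ContinuousOn f (stateSpace d T)) (hg : Continuous g)
    {q : ℕ → ℝ × Eucl d} {p : ℝ × Eucl d} (hq : ∀ n, q n ∈ stateSpace d T)
    (hp : p ∈ stateSpace d T) (hqp : Tendsto q atTop (𝓝 p))
    (hst : ∀ᵐ ω ∂Q, StableHit T Z t₀ A q p ω) :
    Tendsto (fun n => killedExpectation T Q ({t₀} ×ˢ closure A) Z f g (q n)) atTop
      (𝓝 (killedExpectation T Q ({t₀} ×ˢ closure A) Z f g p)) := by
  have hT : 0 < T := ht₀.1.trans_le ht₀.2
  simp only [killedExpectation_eq ht₀.2 hp, killedExpectation_eq ht₀.2 (hq _)]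
  have hle : ∀ p ω, (hitEvent T Z t₀ A p)ᶜ.indicator (fun ω => expNegHalf (runningCost T Z f p ω +
      ENNReal.ofReal (g (clampedPath T Z p T ω)))) ω ≤ 1 := fun p ω =>
    (indicator_le_self _ _ _).trans (expNegHalf_le_one _)
  refine (ENNReal.tendsto_toReal (ne_top_of_le_ne_top ?_ (lintegral_mono (hle p)))).comp ?_
  · simp
  refine tendsto_of_subseq_tendsto fun ns hns => ?_
  obtain ⟨ms, hms, hae⟩ := hR.exists_subseq hZ hT (q := q ∘ ns) (fun n => hq _) hp (hqp.comp hns)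
  have hsub := hns.comp hms.tendsto_atTop
  refine ⟨ms, tendsto_lintegral_of_dominated_convergence' (fun _ => 1) (fun k => ?_)
    (fun k => .of_forall (hle _)) (by simp) ?_⟩
  · refine (continuous_expNegHalf.measurable.comp_aemeasurable ?_).indicator₀
      (hR.nullMeasurableSet_hitEvent (hq _)).compl
    exact (hR.aemeasurable_runningCost hf (hq _)).add (ENNReal.measurable_ofReal.comp_aemeasurable
      (hg.measurable.comp_aemeasurable (hR.nullMeasurable _ (hq _) T).aemeasurable))
  · filter_upwards [hae, hst] with ω hω hs
    have hX := fun {r} => hR.tendsto_clampedPath (q := q ∘ ns ∘ ms) (r := r) (fun n => hq _) hp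
      (hqp.comp hsub) hω
    have hcost := hR.tendsto_runningCost hf (q := q ∘ ns ∘ ms) (fun n => hq _) hp
      (hqp.comp hsub) hω
    have hev := (hs.comp hsub).eventually_mem_iff hA (hqp.comp hsub) (hX ⟨ht₀.1.le, ht₀.2⟩)
    by_cases h : ω ∈ hitEvent T Z t₀ A p
    · refine tendsto_nhds_of_eventually_eq ?_
      filter_upwards [hev] with n hn
      rw [indicator_of_notMem (notMem_compl_iff.2 h), indicator_of_notMem
        (show ω ∉ (hitEvent T Z t₀ A (q (ns (ms n))))ᶜ from notMem_compl_iff.2 (hn.2 h))]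
    · rw [indicator_of_mem h]
      have hlim := (continuous_expNegHalf.tendsto _).comp (hcost.add
        ((ENNReal.continuous_ofReal.comp hg).tendsto _ |>.comp (hX ⟨hT.le, le_rfl⟩)))
      refine hlim.congr' ?_
      filter_upwards [hev] with n hn
      rw [indicator_of_mem (show ω ∈ (hitEvent T Z t₀ A (q (ns (ms n))))ᶜ from
        fun h' => h (hn.1 h'))]
      rfl

/-- As `t₀ > 0`, points at time `t₀` are limits from earlier times. So continuity of `f` on the
closure of `C` means continuity on all of `𝒪`, which is needed because paths may cross the removed
set. -/
lemma stateSpace_subset_closure_diff (ht₀ : t₀ ∈ Ioc 0 T) (B : Set (Eucl d)) :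
    stateSpace d T ⊆ closure (stateSpace d T \ {t₀} ×ˢ B) := by
  rintro ⟨t, z⟩ hp
  by_cases h : t = t₀
  · have hsub : Ico 0 t₀ ×ˢ univ ⊆ stateSpace d T \ {t₀} ×ˢ B := fun x hx =>
      ⟨⟨⟨hx.1.1, hx.1.2.le.trans ht₀.2⟩, trivial⟩, fun h' => hx.1.2.ne h'.1⟩
    refine closure_mono hsub ?_
    rw [closure_prod_eq, closure_Ico ht₀.1.ne, h]
    exact ⟨⟨ht₀.1.le, le_rfl⟩, by simp⟩
  · exact subset_closure ⟨hp, fun h' => h h'.1⟩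

lemma continuousOn_of_seq {X Y : Type*} [PseudoMetricSpace X] [TopologicalSpace Y] {F : X → Y}
    {S : Set X} (h : ∀ p ∈ S, ∀ q : ℕ → X, (∀ n, q n ∈ S) → Tendsto q atTop (𝓝 p) →
      Tendsto (fun n => F (q n)) atTop (𝓝 (F p))) : ContinuousOn F S := by
  intro p hp
  refine tendsto_of_seq_tendsto fun q hq => ?_
  rw [tendsto_nhdsWithin_iff] at hq
  -- A sequence converging within `S` lies in `S` only eventually; its initial terms are dropped.
  obtain ⟨N, hN⟩ := eventually_atTop.1 hq.2
  exact (tendsto_add_atTop_iff_nat N).1 (h p hp (fun n => q (n + N)) (fun n => hN _ (by omega))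
    (hq.1.comp (tendsto_add_atTop_nat N)))

end Flow

end KilledDiffusion

end

open KilledDiffusion in
theorem proposition4p3 {d d' : ℕ} (hd : 1 ≤ d) (hd' : 1 ≤ d') (T : ℝ)
    (μ : ℝ × Eucl d → Eucl d) (σ : ℝ × Eucl d → Matrix (Fin d) (Fin d') ℝ)
    (hcoef : CoefficientConditions T μ σ)
    {Ω : Type*} [mΩ : MeasurableSpace Ω] (Q : Measure Ω) [IsProbabilityMeasure Q]
    (𝒢 : Filtration ℝ mΩ) (W : ℝ → Ω → Eucl d') (hW : IsBrownianMotion T Q 𝒢 W)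
    (Z : ℝ × Eucl d → ℝ → Ω → Eucl d)
    (hZ : ∀ p ∈ stateSpace d T, IsStrongSolution T μ σ Q W p (Z p))
    (hZcont : FlowContinuous T Q Z)
    (t₀ : ℝ) (ht₀ : t₀ ∈ Ioc 0 T) (A₀ : Set (Eucl d)) (hA₀ : IsOpen A₀)
    (D C : Set (ℝ × Eucl d)) (hD : D = {t₀} ×ˢ closure A₀) (hC : C = stateSpace d T \ D)
    (hnull : ∀ t ∈ Ico 0 t₀, ∀ z : Eucl d, Q {ω | Z (t, z) t₀ ω ∈ frontier A₀} = 0) :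
    (∀ p ∈ C, ∀ q : ℕ → ℝ × Eucl d, (∀ n, q n ∈ C) → Tendsto q atTop (𝓝 p) →
      EntryTimesConverge T Q D Z q p) ∧
    (∀ z ∈ A₀, ∀ q : ℕ → ℝ × Eucl d, (∀ n, q n ∈ C ∧ (q n).1 < t₀) →
      Tendsto q atTop (𝓝 (t₀, z)) → EntryTimesConverge T Q D Z q (t₀, z)) ∧
    (∀ (f : ℝ × Eucl d → ℝ) (g : Eucl d → ℝ),
      (∀ p ∈ stateSpace d T, 0 ≤ f p) → (∀ z, 0 ≤ g z) →
      ContinuousOn f (closure C) → Continuous g →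
      ContinuousOn (killedExpectation T Q D Z f g) C ∧
      ContinuousOn (killedExpectation T Q D Z f g)
        (Icc 0 t₀ ×ˢ univ \ {t₀} ×ˢ frontier A₀)) := by
  subst hD hC
  have hR := regularFlow_of_isStrongSolution hW hZ
  refine ⟨fun p hp q hq hqp => ?_, fun z hz q hq hqp => ?_, fun f g _ _ hf hg => ?_⟩
  · exact hR.entryTimesConverge hZcont ht₀ hA₀ (fun n => (hq n).1) hp.1 hqp
      (hR.stableHit_of_mem_compl ht₀.2 hnull hp hqp)
  · exact hR.entryTimesConverge hZcont ht₀ hA₀ (fun n => (hq n).1.1)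
      ⟨⟨ht₀.1.le, ht₀.2⟩, trivial⟩ hqp (hR.stableHit_of_mem ht₀ hA₀ hz fun n => (hq n).2.le)
  have hf' : ContinuousOn f (stateSpace d T) := hf.mono (stateSpace_subset_closure_diff ht₀ _)
  have hsub : Icc 0 t₀ ×ˢ univ ⊆ stateSpace d T := fun x hx =>
    ⟨⟨hx.1.1, hx.1.2.trans ht₀.2⟩, trivial⟩
  refine ⟨continuousOn_of_seq fun p hp q hq hqp => ?_, continuousOn_of_seq fun p hp q hq hqp => ?_⟩
  · exact hR.tendsto_killedExpectation hZcont ht₀ hA₀ hf' hg (fun n => (hq n).1) hp.1 hqp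
      (hR.stableHit_of_mem_compl ht₀.2 hnull hp hqp)
  · refine hR.tendsto_killedExpectation hZcont ht₀ hA₀ hf' hg (fun n => hsub (hq n).1)
      (hsub hp.1) hqp ?_
    -- A point of `{t₀} × closure A₀` off the frontier has its position in `A₀`, and in the slab all
    -- start times are at most `t₀`; any other point lies in `C`.
    by_cases h : p ∈ ({t₀} ×ˢ closure A₀ : Set (ℝ × Eucl d))
    · obtain ⟨t, z⟩ := p
      obtain ⟨ht, hz⟩ := h
      obtain rfl : t = t₀ := ht
      have hmem : z ∈ A₀ := by
        by_contra hnot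
        exact hp.2 ⟨rfl, hz, by rwa [hA₀.interior_eq]⟩
      exact hR.stableHit_of_mem ht₀ hA₀ hmem fun n => (hq n).1.1.2
    · exact hR.stableHit_of_mem_compl ht₀.2 hnull ⟨hsub hp.1, h⟩ hqp
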